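/- A proper left-invariant metric on a countable group $G$ is a metric $d$ with $d(gx,gy)=d(x,y)$ all of whose balls are finite; every countable group has one. A metric space $(X,d)$ has property A if for all $\varepsilon>0$ and $R>0$ there are $S>0$ and finite nonempty sets $A_x\subset X\times\mathbb{N}$ $(x\in X)$ such that $(y,j)\in A_x$ implies $d(x,y)<S$, and $d(x,y)<R$ implies $A_x\cap A_y\neq\emptyset$ and $|A_x\,\triangle\,A_y|/|A_x\cap A_y|<\varepsilon$. A countable group has property A if it has property A as a metric space for a proper left-invariant metric. Let $G$ be a countable group with a proper left-invariant metric $d_G$, and let $\mathcal H=(H_i)_{i\in I}$ be a finite family of subgroups of $G$. Given a $G$-set $K$ and a set $T\subset K$ containing exactly one point of every $G$-orbit, put $$\rho(g,v)=\min\{d_G(e,h) : h\in G,\ ht=g^{-1}v \text{ for some } t\in T\}\qquad (g\in G,\ v\in K).$$ $G$ has relative property A with respect to $\mathcal H$ if there are a countable $G$-set $K$ with finitely many orbits whose point stabilizers are precisely the conjugates of the subgroups $H_i$, and a set $T$ of orbit representatives as above, such that for all $\varepsilon>0$ and $R>0$ there are $S>0$ and finite nonempty sets $A_x\subset K\times\mathbb{N}$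 $(x\in G)$ with: (a) if $(k,j)\in A_x$, then $\rho(x,k)<S$; (b) if $d_G(x,y)<R$, then $|A_x\,\triangle\,A_y|/|A_x|<\varepsilon$. **Corollary.** Let $G$ be a countable group that has relative property A with respect to a finite family of subgroups $\mathcal H=(H_i)_{i\in I}$. Then $G$ has property A if and only if every $H_i$ has property A. Here the proper left-invariant metrics used in relative property A of $G$, in property A of $G$, and in property A of each $H_i$ may be chosen arbitrarily and independently of each other. -/

import Mathlib

/-- A proper left-invariant metric on a group: all balls are finite. -/
structure ProperLeftInvariantMetric (G : Type*) [Group G] where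
  toMetricSpace : MetricSpace G
  dist_mul_left' : ∀ g x y : G, toMetricSpace.dist (g * x) (g * y) = toMetricSpace.dist x y
  finite_ball' : ∀ (x : G) (r : ℝ), {y : G | toMetricSpace.dist x y ≤ r}.Finite

/-- The distance function of a proper left-invariant metric. -/
def ProperLeftInvariantMetric.d {G : Type*} [Group G] (m : ProperLeftInvariantMetric G)
    (x y : G) : ℝ :=
  m.toMetricSpace.dist x y

open Classical in
/-- Yu's property A for a metric space `X`. The inequality
`|A_x ∆ A_y| / |A_x ∩ A_y| < ε` is written without division, so that it forces
`A_x ∩ A_y` to be nonempty. -/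
def YuPropertyA (X : Type*) [MetricSpace X] : Prop :=
  ∀ ε : ℝ, 0 < ε → ∀ R : ℝ, 0 < R →
    ∃ S : ℝ, 0 < S ∧ ∃ A : X → Finset (X × ℕ),
      (∀ x, (A x).Nonempty) ∧
      (∀ x y j, (y, j) ∈ A x → dist x y < S) ∧
      (∀ x y, dist x y < R →
        ((symmDiff (A x) (A y)).card : ℝ) < ε * ((A x ∩ A y).card : ℝ))

/-- Property A of a group equipped with a proper left-invariant metric. -/
def GroupPropertyA {G : Type*} [Group G] (m : ProperLeftInvariantMetric G) : Prop :=
  @YuPropertyA G m.toMetricSpace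

/-- `T` contains exactly one point of every `G`-orbit in `K`. -/
def IsOrbitTransversal (G : Type*) [Group G] {K : Type*} [MulAction G K] (T : Set K) : Prop :=
  ∀ k : K, ∃! t : K, t ∈ T ∧ k ∈ MulAction.orbit G t

/-- The distance `ρ(g, v)` from `g ∈ G` to `v ∈ K` determined by a transversal `T`: the minimal
length of an element `h` with `h • t = g⁻¹ • v`, where `t ∈ T` represents the orbit of `v`
(the minimum exists, because the metric is proper). -/
noncomputable def relDist {G : Type*} [Group G] (m : ProperLeftInvariantMetric G)
    {K : Type*} [MulAction G K] (T : Set K) (g : G) (v : K) : ℝ :=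
  sInf {l : ℝ | ∃ h : G, ∃ t ∈ T, h • t = g⁻¹ • v ∧ l = m.d 1 h}

open Classical in
/-- Relative property A of `G` with respect to the family `H`. Since `K` is countable, letting it
range over `Type` is no restriction. -/
def RelativePropertyA {G : Type*} [Group G] (m : ProperLeftInvariantMetric G)
    {ι : Type*} (H : ι → Subgroup G) : Prop :=
  ∃ (K : Type) (_ : Countable K) (_ : MulAction G K) (T : Set K),
    IsOrbitTransversal G T ∧ T.Finite ∧
    Set.range (fun k : K => MulAction.stabilizer G k) =
      {L : Subgroup G | ∃ (i : ι) (g : G), L = (H i).map (MulAut.conj g).toMonoidHom} ∧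
    ∀ ε : ℝ, 0 < ε → ∀ R : ℝ, 0 < R →
      ∃ S : ℝ, 0 < S ∧ ∃ A : G → Finset (K × ℕ),
        (∀ x, (A x).Nonempty) ∧
        (∀ x k j, (k, j) ∈ A x → relDist m T x k < S) ∧
        (∀ x y, m.d x y < R →
          ((symmDiff (A x) (A y)).card : ℝ) / ((A x).card : ℝ) < ε)

/-! Property A is equivalent to the metric-free `ReiterPropertyA`, because balls are finite and `d x
y` depends only on `x⁻¹ * y`; hence the choice of metrics is irrelevant. Reiter's form passes to
subgroups by pushing distributions forward along an equivariant retraction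
(`ReiterPropertyA.of_injective`). Conversely, relative property A yields slowly varying
distributions `η x` on `K`. Each `k` in `K` indexes a coset of a point stabilizer, on which the
stabilizer's own distributions can be placed; mixing these with weights `η x` gives distributions on
`G` (`ReiterPropertyA.of_stabilizers`). -/

/-- The `ℓ¹`-norm of a finitely supported function. -/
def l1Norm {α : Type*} (f : α →₀ ℝ) : ℝ := f.sum fun _ a => |a|

/-- Finitely supported probability distributions. -/
def IsFinProb {α : Type*} (f : α →₀ ℝ) : Prop :=
  (∀ a, 0 ≤ f a) ∧ f.degree = 1

/-- The convex combination of the `ν k` with weights `η k`. -/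
noncomputable def mixture {κ α : Type*} (η : κ →₀ ℝ) (ν : κ → α →₀ ℝ) : α →₀ ℝ :=
  η.sum fun k a => a • ν k

/-! ### Finitely supported functions in `ℓ¹` and mixtures. -/

section L1

variable {α β κ : Type*}

lemma l1Norm_eq_sum {f : α →₀ ℝ} {s : Finset α} (h : f.support ⊆ s) :
    l1Norm f = ∑ a ∈ s, |f a| :=
  Finsupp.sum_of_support_subset f h _ (by simp)

lemma l1Norm_zero : l1Norm (0 : α →₀ ℝ) = 0 := by simp [l1Norm]

lemma l1Norm_add_le (f g : α →₀ ℝ) : l1Norm (f + g) ≤ l1Norm f + l1Norm g := by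
  classical
  rw [l1Norm_eq_sum (Finsupp.support_add (g₁ := f) (g₂ := g)),
    l1Norm_eq_sum (f := f) Finset.subset_union_left,
    l1Norm_eq_sum (f := g) Finset.subset_union_right, ← Finset.sum_add_distrib]
  exact Finset.sum_le_sum fun a _ => abs_add_le _ _

lemma l1Norm_smul (c : ℝ) (f : α →₀ ℝ) : l1Norm (c • f) = |c| * l1Norm f := by
  rw [l1Norm_eq_sum (Finsupp.support_smul (b := c) (g := f)), l1Norm_eq_sum (f := f) le_rfl,
    Finset.mul_sum]
  exact Finset.sum_congr rfl fun a _ => by simp [abs_mul]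

lemma l1Norm_sum_le (s : Finset κ) (F : κ → α →₀ ℝ) :
    l1Norm (∑ k ∈ s, F k) ≤ ∑ k ∈ s, l1Norm (F k) :=
  Finset.le_sum_of_subadditive l1Norm l1Norm_zero.le l1Norm_add_le s F

lemma l1Norm_single (a : α) (c : ℝ) : l1Norm (Finsupp.single a c) = |c| := by
  simp [l1Norm]

lemma l1Norm_mapDomain_le (φ : α → β) (f : α →₀ ℝ) :
    l1Norm (Finsupp.mapDomain φ f) ≤ l1Norm f := by
  refine (l1Norm_sum_le _ _).trans (le_of_eq ?_)
  simp only [l1Norm_single]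
  rfl

lemma l1Norm_mapDomain_sub_le (φ : α → β) (f g : α →₀ ℝ) :
    l1Norm (Finsupp.mapDomain φ f - Finsupp.mapDomain φ g) ≤ l1Norm (f - g) := by
  have h : Finsupp.mapDomain φ f - Finsupp.mapDomain φ g = Finsupp.mapDomain φ (f - g) :=
    (map_sub (Finsupp.mapDomain.addMonoidHom φ) f g).symm
  exact h ▸ l1Norm_mapDomain_le φ _

lemma degree_eq_sum {f : α →₀ ℝ} {s : Finset α} (h : f.support ⊆ s) :
    f.degree = ∑ a ∈ s, f a :=
  Finsupp.sum_of_support_subset f h (fun _ a => a) (by simp)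

lemma IsFinProb.l1Norm_eq {f : α →₀ ℝ} (hf : IsFinProb f) : l1Norm f = 1 := by
  rw [← hf.2, l1Norm_eq_sum le_rfl, degree_eq_sum le_rfl]
  exact Finset.sum_congr rfl fun a _ => abs_of_nonneg (hf.1 a)

lemma IsFinProb.mapDomain (φ : α → β) {f : α →₀ ℝ} (hf : IsFinProb f) :
    IsFinProb (Finsupp.mapDomain φ f) := by
  classical
  refine ⟨fun b => ?_, ?_⟩
  · rw [Finsupp.mapDomain, Finsupp.sum_apply]
    refine Finset.sum_nonneg fun a _ => ?_
    change 0 ≤ Finsupp.single (φ a) (f a) b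
    rw [Finsupp.single_apply]
    split_ifs
    exacts [hf.1 a, le_rfl]
  · rw [Finsupp.degree_mapDomain, hf.2]

lemma IsFinProb.mixture {η : κ →₀ ℝ} {ν : κ → α →₀ ℝ} (hη : IsFinProb η)
    (hν : ∀ k, IsFinProb (ν k)) : IsFinProb (mixture η ν) := by
  refine ⟨fun a => ?_, ?_⟩
  · rw [_root_.mixture, Finsupp.sum_apply]
    exact Finset.sum_nonneg fun k _ => mul_nonneg (hη.1 k) ((hν k).1 a)
  · have h (k : κ) : (η k • ν k).degree = η k := by
      rw [degree_eq_sum (Finsupp.support_smul (b := η k) (g := ν k))]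
      simp only [Finsupp.smul_apply, smul_eq_mul]
      rw [← Finset.mul_sum, ← degree_eq_sum le_rfl, (hν k).2, mul_one]
    rw [← hη.2, _root_.mixture, Finsupp.sum, map_sum, degree_eq_sum (f := η) le_rfl]
    exact Finset.sum_congr rfl fun k _ => h k

lemma mem_support_mixture {η : κ →₀ ℝ} {ν : κ → α →₀ ℝ} {a : α}
    (ha : a ∈ (mixture η ν).support) : ∃ k ∈ η.support, a ∈ (ν k).support := by
  classical
  obtain ⟨k, hk, h⟩ := Finset.mem_biUnion.1 (Finsupp.support_sum ha)
  exact ⟨k, hk, Finsupp.support_smul h⟩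

lemma l1Norm_mixture_le_mul {η : κ →₀ ℝ} {ν : κ → α →₀ ℝ} {c : ℝ}
    (h : ∀ k ∈ η.support, l1Norm (ν k) ≤ c) : l1Norm (mixture η ν) ≤ l1Norm η * c := by
  refine (l1Norm_sum_le _ _).trans ?_
  rw [l1Norm, Finsupp.sum, Finset.sum_mul]
  refine Finset.sum_le_sum fun k hk => ?_
  rw [l1Norm_smul]
  exact mul_le_mul_of_nonneg_left (h k hk) (abs_nonneg _)

/-- Change the weights first, then the components; the components need comparing only where `η'` is
nonzero. -/
lemma l1Norm_mixture_sub_le {η η' : κ →₀ ℝ} {ν ν' : κ → α →₀ ℝ} {c : ℝ}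
    (hη' : IsFinProb η') (hν : ∀ k, IsFinProb (ν k))
    (h : ∀ k ∈ η'.support, l1Norm (ν k - ν' k) ≤ c) :
    l1Norm (mixture η ν - mixture η' ν') ≤ l1Norm (η - η') + c := by
  have e : mixture η ν - mixture η' ν' =
      mixture (η - η') ν + mixture η' (fun k => ν k - ν' k) := by
    have h1 : mixture (η - η') ν = mixture η ν - mixture η' ν :=
      Finsupp.sum_sub_index fun _ _ _ => sub_smul _ _ _
    have h2 : mixture η' (fun k => ν k - ν' k) = mixture η' ν - mixture η' ν' := by
      simp only [mixture, smul_sub]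
      exact Finsupp.sum_sub
    rw [h1, h2]
    abel
  rw [e]
  refine (l1Norm_add_le _ _).trans (add_le_add ?_ ?_)
  · exact (l1Norm_mixture_le_mul fun k _ => (hν k).l1Norm_eq.le).trans (mul_one _).le
  · exact (l1Norm_mixture_le_mul h).trans (by rw [hη'.l1Norm_eq, one_mul])

end L1

/-! ### From finite sets to distributions. -/

section Uniform

open Classical in
/-- The uniform distribution on a finite subset of `X × ℕ`, pushed forward to `X`. -/
noncomputable def uniformFst {X : Type*} (A : Finset (X × ℕ)) : X →₀ ℝ :=
  Finsupp.mapDomain Prod.fst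
    ((A.card : ℝ)⁻¹ • Finsupp.indicator A fun _ _ => (1 : ℝ))

variable {X : Type*}

lemma isFinProb_uniformFst {A : Finset (X × ℕ)} (hA : A.Nonempty) :
    IsFinProb (uniformFst A) := by
  classical
  have hc : (0 : ℝ) < A.card := by exact_mod_cast hA.card_pos
  refine IsFinProb.mapDomain _ ⟨fun p => ?_, ?_⟩
  · rw [Finsupp.smul_apply, Finsupp.indicator_apply]
    split_ifs <;> simp
  · rw [degree_eq_sum (Finsupp.support_smul.trans (Finsupp.support_indicator_subset _ _))]
    rw [Finset.sum_congr rfl (g := fun _ => (A.card : ℝ)⁻¹)]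
    · simp [hc.ne']
    · intro p hp
      simp [Finsupp.indicator_apply, hp]

lemma mem_support_uniformFst {A : Finset (X × ℕ)} {x : X} (hx : x ∈ (uniformFst A).support) :
    ∃ j, (x, j) ∈ A := by
  classical
  obtain ⟨p, hp, rfl⟩ := Finset.mem_image.1 (Finsupp.mapDomain_support hx)
  exact ⟨p.2, Finsupp.support_indicator_subset _ _ (Finsupp.support_smul hp)⟩

-- Replacing the indicator of `A` by that of `B` costs `|A ∆ B| / |A|`, and renormalizing costs
-- `||B| - |A|| / |A|`, which is no larger.
open Classical in
lemma l1Norm_uniformFst_sub_le {A B : Finset (X × ℕ)} (hA : A.Nonempty) (hB : B.Nonempty) :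
    l1Norm (uniformFst A - uniformFst B) ≤
      2 * ((symmDiff A B).card / (A.card : ℝ)) := by
  have ha : (0 : ℝ) < A.card := by exact_mod_cast hA.card_pos
  have hb : (0 : ℝ) < B.card := by exact_mod_cast hB.card_pos
  refine (l1Norm_mapDomain_sub_le _ _ _).trans ?_
  set a : ℝ := (A.card : ℝ)
  set b : ℝ := (B.card : ℝ)
  let χ (C : Finset (X × ℕ)) : X × ℕ →₀ ℝ := Finsupp.indicator C fun _ _ => (1 : ℝ)
  have hχ (C : Finset (X × ℕ)) (p) : χ C p = if p ∈ C then 1 else 0 := by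
    simp [χ, Finsupp.indicator_apply]
  have e : a⁻¹ • χ A - b⁻¹ • χ B = a⁻¹ • (χ A - χ B) + (a⁻¹ - b⁻¹) • χ B := by
    module
  have h1 : l1Norm (χ A - χ B) ≤ (symmDiff A B).card := by
    have hs : (χ A - χ B).support ⊆ symmDiff A B := by
      intro p hp
      rw [Finsupp.mem_support_iff, Finsupp.sub_apply, hχ, hχ] at hp
      rw [Finset.mem_symmDiff]
      by_cases h1 : p ∈ A <;> by_cases h2 : p ∈ B <;> simp_all
    rw [l1Norm_eq_sum hs]
    refine (Finset.sum_le_card_nsmul _ _ 1 fun p _ => ?_).trans (by simp)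
    rw [Finsupp.sub_apply, hχ, hχ]
    split_ifs <;> simp
  have h2 : l1Norm (χ B) = b := by
    rw [l1Norm_eq_sum (Finsupp.support_indicator_subset _ _),
      Finset.sum_congr rfl (g := fun _ => (1 : ℝ))]
    · simp [b]
    · intro p hp
      rw [hχ, if_pos hp, abs_one]
  have h3 : |b - a| ≤ (symmDiff A B).card := by
    have hA' := Finset.card_inter_add_card_sdiff A B
    have hB' := Finset.card_inter_add_card_sdiff B A
    rw [Finset.inter_comm] at hB'
    have hd : (symmDiff A B).card = (A \ B).card + (B \ A).card :=
      Finset.card_union_of_disjoint disjoint_sdiff_sdiff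
    have hA'' : ((A ∩ B).card : ℝ) + (A \ B).card = a := by
      rw [← Nat.cast_add, hA']
    have hB'' : ((A ∩ B).card : ℝ) + (B \ A).card = b := by
      rw [← Nat.cast_add, hB']
    rw [hd, ← hA'', ← hB'']
    push_cast
    rw [abs_le]
    constructor <;> linarith [Nat.cast_nonneg (α := ℝ) (A \ B).card,
      Nat.cast_nonneg (α := ℝ) (B \ A).card]
  change l1Norm (a⁻¹ • χ A - b⁻¹ • χ B) ≤ _
  rw [e]
  refine (l1Norm_add_le _ _).trans ?_
  rw [l1Norm_smul, l1Norm_smul, h2, abs_of_pos (inv_pos.2 ha)]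
  have h4 : |a⁻¹ - b⁻¹| * b = a⁻¹ * |b - a| := by
    have : a⁻¹ - b⁻¹ = a⁻¹ * b⁻¹ * (b - a) := by field_simp
    rw [this, abs_mul, abs_of_pos (by positivity)]
    field_simp
  rw [h4, div_eq_inv_mul]
  have := inv_pos.2 ha
  nlinarith

end Uniform

/-! ### From distributions back to finite sets. -/

section Subgraph

/-- The points of `X × ℕ` lying below the graph of `⌈M • f⌉₊`. -/
noncomputable def ceilSubgraph {X : Type*} (M : ℝ) (f : X →₀ ℝ) : Finset (X × ℕ) :=
  f.support.sigma (fun x => Finset.range ⌈M * f x⌉₊) |>.map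
    (Equiv.sigmaEquivProd X ℕ).toEmbedding

variable {X : Type*}

lemma mem_ceilSubgraph {M : ℝ} {f : X →₀ ℝ} {x : X} {j : ℕ} :
    (x, j) ∈ ceilSubgraph M f ↔ j < ⌈M * f x⌉₊ := by
  simp only [ceilSubgraph, Finset.mem_map_equiv, Finset.mem_sigma, Finset.mem_range,
    Finsupp.mem_support_iff]
  change f x ≠ 0 ∧ j < ⌈M * f x⌉₊ ↔ _
  refine ⟨And.right, fun h => ⟨fun h0 => ?_, h⟩⟩
  simp [h0] at h

lemma le_card_ceilSubgraph {M : ℝ} {f : X →₀ ℝ} (hf : IsFinProb f) :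
    M ≤ (ceilSubgraph M f).card := by
  rw [ceilSubgraph, Finset.card_map, Finset.card_sigma, Nat.cast_sum]
  calc M = ∑ x ∈ f.support, M * f x := by
        rw [← Finset.mul_sum, ← degree_eq_sum le_rfl, hf.2, mul_one]
    _ ≤ _ := Finset.sum_le_sum fun x _ => by
        rw [Finset.card_range]
        exact Nat.le_ceil _

lemma abs_natCast_ceil_sub_le {a b : ℝ} (ha : 0 ≤ a) (hb : 0 ≤ b) :
    |(⌈a⌉₊ : ℝ) - ⌈b⌉₊| ≤ |a - b| + 1 := by
  have h1 := Nat.le_ceil a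
  have h2 := Nat.le_ceil b
  have h3 := Nat.ceil_lt_add_one ha
  have h4 := Nat.ceil_lt_add_one hb
  have h5 := le_abs_self (a - b)
  have h6 := neg_abs_le (a - b)
  rw [abs_le]
  constructor <;> linarith

-- Over each point the two columns differ in an interval; rounding up adds at most one per point of
-- the supports.
open Classical in
lemma card_symmDiff_ceilSubgraph_le {M : ℝ} (hM : 0 ≤ M) {f g : X →₀ ℝ}
    (hf : IsFinProb f) (hg : IsFinProb g) :
    ((symmDiff (ceilSubgraph M f) (ceilSubgraph M g)).card : ℝ) ≤
      M * l1Norm (f - g) + (f.support.card + g.support.card) := by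
  set U := f.support ∪ g.support
  let I (x : X) : Finset ℕ :=
    Finset.Ico (min ⌈M * f x⌉₊ ⌈M * g x⌉₊) (max ⌈M * f x⌉₊ ⌈M * g x⌉₊)
  have hsub : symmDiff (ceilSubgraph M f) (ceilSubgraph M g) ⊆
      (U.sigma I).map (Equiv.sigmaEquivProd X ℕ).toEmbedding := by
    rintro ⟨x, j⟩ h
    rw [Finset.mem_symmDiff, mem_ceilSubgraph, mem_ceilSubgraph] at h
    simp only [Finset.mem_map_equiv, Finset.mem_sigma, I, Finset.mem_Ico]
    change x ∈ U ∧ min ⌈M * f x⌉₊ ⌈M * g x⌉₊ ≤ j ∧ j < max ⌈M * f x⌉₊ ⌈M * g x⌉₊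
    refine ⟨?_, by omega⟩
    by_contra hx
    simp only [U, Finset.mem_union, Finsupp.mem_support_iff, not_or, not_not] at hx
    simp [hx.1, hx.2] at h
  have hcard (x : X) : ((I x).card : ℝ) ≤ M * |f x - g x| + 1 := by
    have h1 : ((I x).card : ℝ) = |(⌈M * f x⌉₊ : ℝ) - ⌈M * g x⌉₊| := by
      rw [Nat.card_Ico, Nat.cast_sub (by simp), Nat.cast_max, Nat.cast_min, max_sub_min_eq_abs]
      exact abs_sub_comm _ _
    rw [h1]
    refine (abs_natCast_ceil_sub_le (mul_nonneg hM (hf.1 x)) (mul_nonneg hM (hg.1 x))).trans ?_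
    rw [← mul_sub, abs_mul, abs_of_nonneg hM]
  have hU : (U.card : ℝ) ≤ f.support.card + g.support.card := by
    exact_mod_cast Finset.card_union_le _ _
  calc ((symmDiff (ceilSubgraph M f) (ceilSubgraph M g)).card : ℝ)
      ≤ ((∑ x ∈ U, (I x).card : ℕ) : ℝ) := by
        refine Nat.cast_le.2 ((Finset.card_le_card hsub).trans ?_)
        rw [Finset.card_map, Finset.card_sigma]
    _ ≤ ∑ x ∈ U, (M * |f x - g x| + 1) := by
        push_cast
        exact Finset.sum_le_sum fun x _ => hcard x
    _ = M * l1Norm (f - g) + U.card := by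
        rw [l1Norm_eq_sum (s := U) Finsupp.support_sub, Finset.sum_add_distrib, Finset.mul_sum]
        simp
    _ ≤ _ := by linarith

end Subgraph

/-! ### Reiter's condition: equivalence with property A, and subgroups. -/

/-- Reiter's form of property A, which does not refer to a metric: there are finitely supported
probability distributions on the group, of uniformly bounded support, that vary slowly in `ℓ¹`. -/
def ReiterPropertyA (G : Type*) [Group G] : Prop :=
  ∀ ε : ℝ, 0 < ε → ∀ E : Finset G, ∃ (F : Finset G) (ξ : G → G →₀ ℝ),
    (∀ x, IsFinProb (ξ x)) ∧ (∀ x, ∀ y ∈ (ξ x).support, x⁻¹ * y ∈ F) ∧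
    ∀ x y, x⁻¹ * y ∈ E → l1Norm (ξ x - ξ y) ≤ ε

section Reiter

variable {G : Type*} [Group G]

lemma ProperLeftInvariantMetric.d_eq_d_one (m : ProperLeftInvariantMetric G) (x y : G) :
    m.d x y = m.d 1 (x⁻¹ * y) := by
  have := m.dist_mul_left' x⁻¹ x y
  rw [inv_mul_cancel] at this
  exact this.symm

lemma ProperLeftInvariantMetric.exists_forall_d_lt (m : ProperLeftInvariantMetric G)
    (E : Finset G) : ∃ R : ℝ, 0 < R ∧ ∀ g ∈ E, m.d 1 g < R := by
  refine ⟨∑ g ∈ E, |m.d 1 g| + 1,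
    add_pos_of_nonneg_of_pos (Finset.sum_nonneg fun _ _ => abs_nonneg _) one_pos, fun g hg => ?_⟩
  exact (le_abs_self _).trans_lt <| lt_of_le_of_lt
    (Finset.single_le_sum (f := fun g => |m.d 1 g|) (fun _ _ => abs_nonneg _) hg)
    (lt_add_one _)

lemma ReiterPropertyA.of_groupPropertyA {m : ProperLeftInvariantMetric G}
    (h : GroupPropertyA m) : ReiterPropertyA G := by
  classical
  intro ε hε E
  obtain ⟨R, hR, hER⟩ := m.exists_forall_d_lt E
  obtain ⟨S, -, A, hne, hS, hA⟩ := h (ε / 2) (half_pos hε) R hR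
  refine ⟨(m.finite_ball' 1 S).toFinset, fun x => uniformFst (A x),
    fun x => isFinProb_uniformFst (hne x), fun x y hy => ?_, fun x y hxy => ?_⟩
  · obtain ⟨j, hj⟩ := mem_support_uniformFst hy
    have h1 : m.d x y < S := hS x y j hj
    rw [m.d_eq_d_one] at h1
    exact (m.finite_ball' 1 S).mem_toFinset.2 h1.le
  · have h1 := hA x y (by
      change m.d x y < R
      rw [m.d_eq_d_one]
      exact hER _ hxy)
    have hc : (0 : ℝ) < (A x).card := by exact_mod_cast (hne x).card_pos
    have hi : ((A x ∩ A y).card : ℝ) ≤ (A x).card := by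
      exact_mod_cast Finset.card_le_card Finset.inter_subset_left
    have h2 : ((symmDiff (A x) (A y)).card : ℝ) / (A x).card ≤ ε / 2 := by
      rw [div_le_iff₀ hc]
      have h3 := mul_le_mul_of_nonneg_left hi (half_pos hε).le
      convert h1.le.trans h3
    refine (l1Norm_uniformFst_sub_le (hne x) (hne y)).trans ?_
    have h4 : 2 * (((symmDiff (A x) (A y)).card : ℝ) / (A x).card) ≤ ε := by linarith
    convert h4

lemma ReiterPropertyA.groupPropertyA (h : ReiterPropertyA G) (m : ProperLeftInvariantMetric G) :
    GroupPropertyA m := by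
  classical
  intro ε hε R _
  -- With `2 * |F| ≤ M * δ`, rounding costs no more than the `ℓ¹` error, so `|A ∆ B| ≤ 2 * M * δ`.
  -- This `δ` gives `(1 + ε) * |A ∆ B| ≤ M * ε / 2 < ε * |A|`, and `|A| ≤ |A ∩ B| + |A ∆ B|` turns
  -- that into the required bound.
  set δ : ℝ := ε / (4 * (1 + ε)) with hδ
  have hδ0 : 0 < δ := by positivity
  obtain ⟨F, ξ, hξ, hF, hE⟩ := h δ hδ0 (m.finite_ball' 1 R).toFinset
  let M : ℝ := 2 * F.card / δ + 1
  have hM : 0 < M := by positivity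
  have hFM : 2 * F.card ≤ M * δ := by
    have : M * δ = 2 * F.card + δ := by
      simp only [M]
      field_simp
    linarith
  have hcard (x : G) : ((ξ x).support.card : ℝ) ≤ F.card := by
    refine Nat.cast_le.2 (Finset.card_le_card_of_injOn (fun y => x⁻¹ * y) (hF x) ?_)
    exact (mul_right_injective x⁻¹).injOn
  obtain ⟨S, hS, hFS⟩ := m.exists_forall_d_lt F
  refine ⟨S, hS, fun x => ceilSubgraph M (ξ x), fun x => ?_, fun x y j hy => ?_,
    fun x y hxy => ?_⟩
  · have h1 := le_card_ceilSubgraph (M := M) (hξ x)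
    rw [← Finset.card_pos]
    exact_mod_cast hM.trans_le h1
  · rw [mem_ceilSubgraph] at hy
    have hy' : y ∈ (ξ x).support := by
      rw [Finsupp.mem_support_iff]
      intro h0
      simp [h0] at hy
    change m.d x y < S
    rw [m.d_eq_d_one]
    exact hFS _ (hF x y hy')
  · have h1 : l1Norm (ξ x - ξ y) ≤ δ := by
      refine hE x y ?_
      change m.d x y < R at hxy
      rw [m.d_eq_d_one] at hxy
      exact (m.finite_ball' 1 R).mem_toFinset.2 hxy.le
    have h2 := card_symmDiff_ceilSubgraph_le hM.le (hξ x) (hξ y)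
    have h3 := le_card_ceilSubgraph (M := M) (hξ x)
    set A := ceilSubgraph M (ξ x)
    set B := ceilSubgraph M (ξ y)
    have h4 : (A.card : ℝ) ≤ (A ∩ B).card + (symmDiff A B).card := by
      rw [← Finset.card_inter_add_card_sdiff A B]
      push_cast
      gcongr
      exact Finset.subset_union_left
    have h5 : M * l1Norm (ξ x - ξ y) ≤ M * δ := mul_le_mul_of_nonneg_left h1 hM.le
    have h6 : ((symmDiff A B).card : ℝ) ≤ 2 * (M * δ) := by linarith [hcard x, hcard y]
    have h7 : 2 * (M * δ) * (1 + ε) = M * ε / 2 := by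
      rw [hδ]
      field_simp
      ring
    have h8 : 0 < M * ε := by positivity
    have h9 : ((symmDiff A B).card : ℝ) < ε * (A ∩ B).card := by
      have := mul_le_mul_of_nonneg_right h6 (by positivity : 0 ≤ 1 + ε)
      have := mul_le_mul_of_nonneg_left (h3.trans h4) hε.le
      linarith
    convert h9

/-- With `r y` a representative of the right coset of `y`, the element `y * (r y)⁻¹` lies in the
image of `φ`; its preimage is `π y`. -/
lemma exists_equivariant_retraction {L : Type*} [Group L] {φ : L →* G}
    (hφ : Function.Injective φ) : ∃ π : G → L, ∀ l y, π (φ l * y) = l * π y := by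
  let r (y : G) : G :=
    (Quotient.mk (QuotientGroup.rightRel φ.range) y).out
  have hr (y : G) : y * (r y)⁻¹ ∈ φ.range :=
    QuotientGroup.rightRel_apply.1 (Quotient.mk_out (s := QuotientGroup.rightRel φ.range) y)
  choose π hπ using hr
  refine ⟨π, fun l y => hφ ?_⟩
  have h : r (φ l * y) = r y := by
    refine congrArg Quotient.out (Quotient.sound ?_)
    refine QuotientGroup.rightRel_apply.2 ⟨l⁻¹, ?_⟩
    simp
  rw [map_mul, hπ, hπ, h, mul_assoc]

lemma ReiterPropertyA.of_injective {L : Type*} [Group L] {φ : L →* G}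
    (hφ : Function.Injective φ) (h : ReiterPropertyA G) : ReiterPropertyA L := by
  classical
  obtain ⟨π, hπ⟩ := exists_equivariant_retraction hφ
  intro ε hε E
  obtain ⟨F, ξ, hξ, hF, hE⟩ := h ε hε (E.image φ)
  refine ⟨F.image π, fun l => (ξ (φ l)).mapDomain π, fun l => (hξ _).mapDomain π,
    fun l l' hl' => ?_, fun l l' hl' => ?_⟩
  · obtain ⟨y, hy, rfl⟩ := Finset.mem_image.1 (Finsupp.mapDomain_support hl')
    refine Finset.mem_image.2 ⟨_, hF _ y hy, ?_⟩
    rw [← map_inv, hπ]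
  · refine (l1Norm_mapDomain_sub_le _ _ _).trans (hE _ _ ?_)
    refine Finset.mem_image.2 ⟨_, hl', ?_⟩
    rw [map_mul, map_inv]

end Reiter

/-! ### Gluing along a `G`-set. -/

section Relative

variable {G : Type*} [Group G] {K : Type*} [MulAction G K]

lemma exists_of_relDist_lt {m : ProperLeftInvariantMetric G} {T : Set K}
    (hT : IsOrbitTransversal G T) {g : G} {v : K} {S : ℝ} (h : relDist m T g v < S) :
    ∃ a : G, m.d 1 a < S ∧ ∃ t ∈ T, a • t = g⁻¹ • v := by
  -- Nonemptiness is needed: the infimum of the empty set would be the default `0`.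
  obtain ⟨t, ⟨ht, a, ha⟩, -⟩ := hT (g⁻¹ • v)
  obtain ⟨_, ⟨b, u, hu, hb, rfl⟩, hlt⟩ :=
    exists_lt_of_csInf_lt (s := {l : ℝ | ∃ h : G, ∃ t ∈ T, h • t = g⁻¹ • v ∧ l = m.d 1 h})
      ⟨_, a, t, ht, ha, rfl⟩ h
  exact ⟨b, hlt, u, hu, hb⟩

/-- Property A passes from the point stabilizers to `G` along slowly varying distributions on a
`G`-set. -/
lemma ReiterPropertyA.of_stabilizers {T : Set K} (hT : IsOrbitTransversal G T)
    (hst : ∀ k : K, ReiterPropertyA (MulAction.stabilizer G k))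
    (hη : ∀ ε : ℝ, 0 < ε → ∀ E : Finset G, ∃ (B : Finset K) (η : G → K →₀ ℝ),
      (∀ x, IsFinProb (η x)) ∧ (∀ x, ∀ k ∈ (η x).support, x⁻¹ • k ∈ B) ∧
      ∀ x y, x⁻¹ * y ∈ E → l1Norm (η x - η y) ≤ ε) : ReiterPropertyA G := by
  classical
  have hex (k : K) : ∃ t ∈ T, ∃ g : G, g • t = k := by
    obtain ⟨t, ⟨ht, g, hg⟩, -⟩ := hT k
    exact ⟨t, ht, g, hg⟩
  choose τ hτT g hg using hex
  have hτ (a : G) (k : K) : τ (a • k) = τ k := by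
    refine (hT k).unique ⟨hτT _, ?_⟩ ⟨hτT k, g k, hg k⟩
    refine ⟨a⁻¹ * g (a • k), ?_⟩
    change (a⁻¹ * g (a • k)) • τ (a • k) = k
    rw [mul_smul, hg, inv_smul_smul]
  have hs (k : K) (x : G) : (g k)⁻¹ * x * g (x⁻¹ • k) ∈ MulAction.stabilizer G (τ k) := by
    have h := hg (x⁻¹ • k)
    rw [hτ] at h
    rw [MulAction.mem_stabilizer_iff, mul_smul, mul_smul, h, smul_inv_smul, inv_smul_eq_iff, hg]
  -- Since `(s k x)⁻¹ * s k y = (g (x⁻¹ • k))⁻¹ * (x⁻¹ * y) * g (y⁻¹ • k)`, this quotient takes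
  -- finitely many values once `x⁻¹ * y`, `x⁻¹ • k` and `y⁻¹ • k` do.
  let s (k : K) (x : G) : MulAction.stabilizer G (τ k) := ⟨_, hs k x⟩
  intro ε hε E
  obtain ⟨B, η, hηp, hB, hηE⟩ := hη (ε / 2) (half_pos hε) E
  -- Only `y⁻¹ • k ∈ B` will be known, so `B` is enlarged to contain `x⁻¹ • k = (x⁻¹ * y) • (y⁻¹ •
  -- k)`.
  let B' : Finset K := B ∪ (E ×ˢ B).image fun p => p.1 • p.2
  let E' : Finset G :=
    ((B' ×ˢ B') ×ˢ E).image fun p => (g p.1.1)⁻¹ * p.2 * g p.1.2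
  have hζ (t : K) := hst t (ε / 2) (half_pos hε)
    (E'.preimage ((↑) : MulAction.stabilizer G t → G) Subtype.val_injective.injOn)
  choose F ζ hζp hF hζE using hζ
  let ν (x : G) (k : K) : G →₀ ℝ :=
    (ζ (τ k) (s k x)).mapDomain fun l : MulAction.stabilizer G (τ k) => g k * (l : G)
  have hν (x : G) (k : K) : IsFinProb (ν x k) := (hζp _ _).mapDomain _
  refine ⟨B.biUnion fun b => (F (τ b)).image fun l : MulAction.stabilizer G (τ b) => g b * (l : G),
    fun x => mixture (η x) (ν x), fun x => (hηp x).mixture (hν x), fun x y hy => ?_,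
    fun x y hxy => ?_⟩
  · obtain ⟨k, hk, hyk⟩ := mem_support_mixture hy
    obtain ⟨l, hl, rfl⟩ := Finset.mem_image.1 (Finsupp.mapDomain_support hyk)
    refine Finset.mem_biUnion.2 ⟨x⁻¹ • k, hB x k hk, ?_⟩
    rw [hτ]
    refine Finset.mem_image.2 ⟨_, hF _ _ l hl, ?_⟩
    simp only [s, Subgroup.coe_mul, Subgroup.coe_inv]
    group
  · refine (l1Norm_mixture_sub_le (c := ε / 2) (hηp y) (hν x) fun k hk => ?_).trans
      (by linarith [hηE x y hxy])
    refine (l1Norm_mapDomain_sub_le _ _ _).trans (hζE _ _ _ ?_)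
    have hyB : y⁻¹ • k ∈ B := hB y k hk
    have hxB : x⁻¹ • k ∈ B' := by
      refine Finset.mem_union_right _ (Finset.mem_image.2
        ⟨(x⁻¹ * y, y⁻¹ • k), Finset.mem_product.2 ⟨hxy, hyB⟩, ?_⟩)
      simp [mul_smul]
    rw [Finset.mem_preimage]
    refine Finset.mem_image.2 ⟨((x⁻¹ • k, y⁻¹ • k), x⁻¹ * y),
      Finset.mem_product.2 ⟨Finset.mem_product.2 ⟨hxB, Finset.mem_union_left _ hyB⟩, hxy⟩, ?_⟩
    simp only [s, Subgroup.coe_mul, Subgroup.coe_inv]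
    group

/-- A bound on `relDist m T x k` confines `x⁻¹ • k` to a ball applied to the finite set `T`, hence
to a finite set; the stabilizers are isomorphic to the `H i`. -/
lemma RelativePropertyA.reiterPropertyA {m : ProperLeftInvariantMetric G} {ι : Type*}
    {H : ι → Subgroup G} (hrel : RelativePropertyA m H) (hH : ∀ i, ReiterPropertyA (H i)) :
    ReiterPropertyA G := by
  classical
  obtain ⟨K, _, _, T, hT, hTfin, hstab, hA⟩ := hrel
  refine ReiterPropertyA.of_stabilizers hT (fun k => ?_) fun ε hε E => ?_
  · obtain ⟨i, g, hig⟩ := hstab.subset ⟨k, rfl⟩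
    replace hig : MulAction.stabilizer G k = (H i).map (MulAut.conj g).toMonoidHom := hig
    rw [hig]
    let e := (H i).equivMapOfInjective (MulAut.conj g).toMonoidHom (MulAut.conj g).injective
    exact (hH i).of_injective (φ := e.symm.toMonoidHom) e.symm.injective
  · obtain ⟨R, hR, hER⟩ := m.exists_forall_d_lt E
    obtain ⟨S, -, A, hne, hS, hAR⟩ := hA (ε / 2) (half_pos hε) R hR
    refine ⟨((m.finite_ball' 1 S).toFinset ×ˢ hTfin.toFinset).image fun p => p.1 • p.2,
      fun x => uniformFst (A x), fun x => isFinProb_uniformFst (hne x), fun x k hk => ?_,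
      fun x y hxy => ?_⟩
    · obtain ⟨j, hj⟩ := mem_support_uniformFst hk
      obtain ⟨a, ha, t, ht, hat⟩ := exists_of_relDist_lt hT (hS x k j hj)
      refine Finset.mem_image.2 ⟨(a, t), Finset.mem_product.2 ⟨?_, by simpa using ht⟩, hat⟩
      exact (m.finite_ball' 1 S).mem_toFinset.2 ha.le
    · have h1 := hAR x y (by
        rw [m.d_eq_d_one]
        exact hER _ hxy)
      refine (l1Norm_uniformFst_sub_le (hne x) (hne y)).trans ?_
      have h2 : 2 * (((symmDiff (A x) (A y)).card : ℝ) / (A x).card) ≤ ε := by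
        have h3 : ((symmDiff (A x) (A y)).card : ℝ) / (A x).card < ε / 2 := by convert h1
        linarith
      convert h2

end Relative

theorem mainTheorem1 {G : Type*} [Group G] [Countable G] {ι : Type*} [Finite ι]
    (H : ι → Subgroup G) (dRel dG : ProperLeftInvariantMetric G)
    (dH : ∀ i, ProperLeftInvariantMetric (H i))
    (hrel : RelativePropertyA dRel H) :
    GroupPropertyA dG ↔ ∀ i, GroupPropertyA (dH i) := by
  refine ⟨fun hG i => ?_, fun hH => ?_⟩
  · exact ((ReiterPropertyA.of_groupPropertyA hG).of_injective
      (H i).subtype_injective).groupPropertyA (dH i)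
  · exact (hrel.reiterPropertyA fun i =>
      ReiterPropertyA.of_groupPropertyA (hH i)).groupPropertyA dG
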